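/- Let $n\ge 1$, $1<p<\infty$, and let $X\subseteq\mathbb{R}^n$ be either a bounded cube or all of $\mathbb{R}^n$; here a cube is an open cube with edges parallel to the coordinate axes, $l(Q)$ is the side length of a cube $Q$, $|Q|$ is its Lebesgue measure, and $f_Q=\frac1{|Q|}\int_Q f$. A real-valued function $f\in L^1_{\mathrm{loc}}(X)$ belongs to the John--Nirenberg space $JN_p(X)$ if there is a constant $K<\infty$ such that $$\sum_{i}|Q_i|\left(\frac1{|Q_i|}\int_{Q_i}|f-f_{Q_i}|\right)^p\le K^p$$ for every countable collection $(Q_i)$ of pairwise disjoint cubes contained in $X$ (if $f$ is not integrable over a cube $Q$, its mean oscillation over $Q$ is counted as $+\infty$). Theorem. Let $f\in JN_p(X)$. Then $$\lim_{a\to 0^+}\ \sup_{\substack{Q\subseteq X\\ l(Q)\le a}}|Q|^{1/p}\,\frac1{|Q|}\int_Q|f|=0,$$ where the supremum is taken over all cubes $Q\subseteq X$ with side length at most $a$. In particular, if $X$ is a bounded cube, then $f$ belongs to the vanishing Morrey space $VL^{1,\lambda}(X)$ with $\lambda=n-\frac np$; that is, $f$ is measurable on $X$, $$\sup_{x\in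 X,\ \rho>0}\rho^{-\lambda}\int_{B(x,\rho)\cap X}|f|<\infty\qquad\text{and}\qquad \lim_{r\to0^+}\ \sup_{x\in X,\ 0<\rho<r}\rho^{-\lambda}\int_{B(x,\rho)\cap X}|f|=0,$$ where $B(x,\rho)$ is the open Euclidean ball with centre $x$ and radius $\rho$. -/

import Mathlib

open MeasureTheory Filter Topology
open scoped ENNReal NNReal

namespace JohnNirenberg

/-- The open cube in `ℝⁿ` with edges parallel to the axes, centre `c` and side length `l`. -/
def cube {n : ℕ} (c : EuclideanSpace ℝ (Fin n)) (l : ℝ) : Set (EuclideanSpace ℝ (Fin n)) :=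
  {x | ∀ i, |x i - c i| < l / 2}

/-- `Q` is a (bounded, open, nonempty) cube with edges parallel to the axes. -/
def IsCube {n : ℕ} (Q : Set (EuclideanSpace ℝ (Fin n))) : Prop :=
  ∃ (c : EuclideanSpace ℝ (Fin n)) (l : ℝ), 0 < l ∧ Q = cube c l

/-- The mean oscillation `⨍_Q |f - f_Q|`, with values in `[0, ∞]`; it is `∞` on a cube `Q` on
which a measurable `f` is not integrable. -/
noncomputable def meanOsc {n : ℕ} (f : EuclideanSpace ℝ (Fin n) → ℝ)
    (Q : Set (EuclideanSpace ℝ (Fin n))) : ℝ≥0∞ :=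
  ⨍⁻ x in Q, ‖f x - (⨍ y in Q, f y ∂volume)‖ₑ ∂volume

/-- Membership in the John-Nirenberg space `JN_p(X)`. Only the values of `f` on `X` matter. -/
def MemJN {n : ℕ} (p : ℝ) (X : Set (EuclideanSpace ℝ (Fin n)))
    (f : EuclideanSpace ℝ (Fin n) → ℝ) : Prop :=
  LocallyIntegrableOn f X ∧
    ∃ K : ℝ≥0, ∀ S : Set (Set (EuclideanSpace ℝ (Fin n))), S.Countable →
      (∀ Q ∈ S, IsCube Q ∧ Q ⊆ X) → S.PairwiseDisjoint id →
        ∑' Q : S, volume (Q : Set (EuclideanSpace ℝ (Fin n))) * meanOsc f Q ^ p ≤ (K : ℝ≥0∞) ^ p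

/-- The supremum of `|Q|^{1/p} ⨍_Q |f|` over all cubes `Q ⊆ X` of side length at most `a`. -/
noncomputable def smallCubeSup {n : ℕ} (p : ℝ) (X : Set (EuclideanSpace ℝ (Fin n)))
    (f : EuclideanSpace ℝ (Fin n) → ℝ) (a : ℝ) : ℝ≥0∞ :=
  ⨆ (c : EuclideanSpace ℝ (Fin n)) (l : ℝ) (_ : 0 < l) (_ : l ≤ a) (_ : cube c l ⊆ X),
    volume (cube c l) ^ (1 / p) * ⨍⁻ x in cube c l, ‖f x‖ₑ ∂volume

/-- The Morrey quantity `ρ^{-s} ∫_{B(x,ρ) ∩ Ω} |f|^q`, with Euclidean balls `B(x,ρ)`. -/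
noncomputable def morreyTerm {n : ℕ} (q s : ℝ) (Ω : Set (EuclideanSpace ℝ (Fin n)))
    (f : EuclideanSpace ℝ (Fin n) → ℝ) (x : EuclideanSpace ℝ (Fin n)) (ρ : ℝ) : ℝ≥0∞ :=
  ENNReal.ofReal (ρ ^ (-s)) * ∫⁻ y in Metric.ball x ρ ∩ Ω, ‖f y‖ₑ ^ q

/-- Membership in the Morrey space `L^{q,s}(Ω)`. -/
def MemMorrey {n : ℕ} (q s : ℝ) (Ω : Set (EuclideanSpace ℝ (Fin n)))
    (f : EuclideanSpace ℝ (Fin n) → ℝ) : Prop :=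
  AEStronglyMeasurable f (volume.restrict Ω) ∧
    ⨆ (x ∈ Ω) (ρ : ℝ) (_ : 0 < ρ), morreyTerm q s Ω f x ρ < ∞

/-- Membership in the vanishing Morrey space `VL^{q,s}(Ω)`: the functions in `L^{q,s}(Ω)` whose
Morrey quantities over balls of radius `ρ < r` tend to `0` uniformly as `r → 0`. -/
def MemVanishingMorrey {n : ℕ} (q s : ℝ) (Ω : Set (EuclideanSpace ℝ (Fin n)))
    (f : EuclideanSpace ℝ (Fin n) → ℝ) : Prop :=
  MemMorrey q s Ω f ∧
    Tendsto (fun r : ℝ => ⨆ (x ∈ Ω) (ρ : ℝ) (_ : 0 < ρ) (_ : ρ < r), morreyTerm q s Ω f x ρ)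
      (𝓝[>] 0) (𝓝 0)

end JohnNirenberg

/-! Disjoint cubes with `volume T * meanOsc f T ^ p > η` cannot form an infinite sequence, so such
cubes can only persist where no disjoint subsequence can be extracted. `MemJN.exists_mem_filter`
phrases this for a filter. With `𝓝 x₀`, cubes close to `x₀` whose closure misses `x₀` have small
oscillation. With the cobounded filter, so do cubes far from the origin.

Small oscillation passes to averages by telescoping along a chain of doubling cubes. If every cube
of the chain has normalized oscillation at most `ε`, the oscillation at side `2 ^ j * l` is at most
`ε * (2 ^ j * l) ^ (-n/p)`. The geometric sum is of the order of its first term, and multiplying by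
`l ^ (n/p)` leaves a constant times `ε` plus `l ^ (n/p)` times the average over the last, large cube
(`rpow_mul_lintegral_le_chain`). That last term vanishes as `l → 0` once the large averages are
bounded.

Near `x₀` the chain must avoid `x₀`, so a cube inside one orthant at `x₀` is grown diagonally away
from it (`MemJN.eventually_orthant`). Any other cube is split among the orthants. Compactness makes
this uniform on bounded sets; on the whole space the cobounded filter handles the rest. -/

namespace JohnNirenberg

variable {n : ℕ}

/-! ### Cubes and their volume -/

theorem isOpen_cube (c : EuclideanSpace ℝ (Fin n)) (l : ℝ) : IsOpen (cube c l) := by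
  have : cube c l = ⋂ i, {x : EuclideanSpace ℝ (Fin n) | |x i - c i| < l / 2} := by
    ext x; simp [cube]
  rw [this]
  exact isOpen_iInter_of_finite fun i => isOpen_lt (by fun_prop) continuous_const

theorem volume_cube (c : EuclideanSpace ℝ (Fin n)) {l : ℝ} (hl : 0 < l) :
    volume (cube c l) = ENNReal.ofReal (l ^ n) := by
  have h : cube c l = (MeasurableEquiv.toLp 2 (Fin n → ℝ)).symm ⁻¹'
      Metric.ball (fun i => c i) (l / 2) := by
    ext x
    simp only [cube, Set.mem_ofPred_eq, Set.mem_preimage, Metric.mem_ball]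
    rw [dist_pi_lt_iff (by positivity)]
    rfl
  rw [h, (EuclideanSpace.volume_preserving_symm_measurableEquiv_toLp (Fin n)).measure_preimage
    Metric.isOpen_ball.measurableSet.nullMeasurableSet, Real.volume_pi_ball _ (by positivity)]
  simp [mul_div_cancel₀]

theorem volume_cube_ne_zero (c : EuclideanSpace ℝ (Fin n)) {l : ℝ} (hl : 0 < l) :
    volume (cube c l) ≠ 0 := by
  rw [volume_cube c hl]; simpa using pow_pos hl n

theorem volume_cube_ne_top (c : EuclideanSpace ℝ (Fin n)) {l : ℝ} (hl : 0 < l) :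
    volume (cube c l) ≠ ∞ := by
  rw [volume_cube c hl]; exact ENNReal.ofReal_ne_top

theorem cube_subset_cube {c d : EuclideanSpace ℝ (Fin n)} {l m : ℝ}
    (h : ∀ i, |c i - d i| ≤ (m - l) / 2) : cube c l ⊆ cube d m := by
  intro x hx i
  have h1 := hx i
  have h2 := h i
  rw [abs_lt] at h1 ⊢
  rw [abs_le] at h2
  constructor <;> linarith [h1.1, h1.2, h2.1, h2.2]

/-- Makes the cut of a cube along the coordinate hyperplanes through `x₀` lossless for integrals. -/
theorem ae_coord_ne (x₀ : EuclideanSpace ℝ (Fin n)) :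
    ∀ᵐ x : EuclideanSpace ℝ (Fin n), ∀ i, x i ≠ x₀ i := by
  rw [ae_all_iff]
  intro i
  have h : ∀ᵐ y : Fin n → ℝ, y i ≠ x₀ i :=
    Measure.ae_eval_ne (μ := fun _ : Fin n => (volume : Measure ℝ)) i (x₀ i)
  exact (EuclideanSpace.volume_preserving_symm_measurableEquiv_toLp
    (Fin n)).quasiMeasurePreserving.ae h

/-! ### Oscillation, averages and telescoping -/

variable {p : ℝ} {X : Set (EuclideanSpace ℝ (Fin n))} {f : EuclideanSpace ℝ (Fin n) → ℝ}

theorem MemJN.exists_cube_bound (hf : MemJN p X f) :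
    ∃ K : ℝ≥0, ∀ Q, IsCube Q → Q ⊆ X → volume Q * meanOsc f Q ^ p ≤ (K : ℝ≥0∞) ^ p := by
  obtain ⟨-, K, hK⟩ := hf
  refine ⟨K, fun Q hQ hQX => ?_⟩
  have h := hK {Q} (Set.countable_singleton Q) (by simp [hQ, hQX]) (by simp)
  rwa [tsum_singleton Q (fun Q => volume Q * meanOsc f Q ^ p)] at h

/-- Local integrability on `X` does not control `f` up to the boundary of a cube. Finite oscillation
does: `f` minus a constant is integrable, whatever value the average takes by default. -/
theorem MemJN.integrableOn_cube (hp : 1 < p) (hf : MemJN p X f)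
    {c : EuclideanSpace ℝ (Fin n)} {l : ℝ} (hl : 0 < l) (hX : cube c l ⊆ X) :
    IntegrableOn f (cube c l) := by
  obtain ⟨K, hK⟩ := hf.exists_cube_bound
  have h := hK _ ⟨c, l, hl, rfl⟩ hX
  have hO : meanOsc f (cube c l) ≠ ∞ := by
    intro hO
    rw [hO, ENNReal.top_rpow_of_pos (by linarith), ENNReal.mul_top (volume_cube_ne_zero c hl)] at h
    exact ENNReal.rpow_ne_top_of_nonneg (by linarith : 0 ≤ p) (ENNReal.coe_ne_top (r := K))
      (top_le_iff.1 h)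
  have hm : AEStronglyMeasurable f (volume.restrict (cube c l)) :=
    (hf.1.mono_set hX).aestronglyMeasurable
  have hfin : IsFiniteMeasure (volume.restrict (cube c l)) :=
    ⟨by simpa using (volume_cube_ne_top c hl).lt_top⟩
  have hg : IntegrableOn (fun x => f x - ⨍ y in cube c l, f y) (cube c l) := by
    refine ⟨hm.sub aestronglyMeasurable_const, ?_⟩
    rw [hasFiniteIntegral_iff_enorm]
    rw [meanOsc, setLAverage_eq] at hO
    refine lt_top_iff_ne_top.2 fun h => hO ?_
    rw [h, ENNReal.top_div_of_ne_top (volume_cube_ne_top c hl)]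
  have := hg.add (integrable_const (⨍ y in cube c l, f y))
  refine this.congr (Eventually.of_forall fun x => ?_)
  simp

theorem setLAverage_enorm_le (c : EuclideanSpace ℝ (Fin n)) {l : ℝ} (hl : 0 < l) :
    (⨍⁻ x in cube c l, ‖f x‖ₑ ∂volume) ≤ ‖⨍ x in cube c l, f x‖ₑ + meanOsc f (cube c l) := by
  set b := ⨍ x in cube c l, f x with hb
  have h0 := volume_cube_ne_zero c hl
  have ht := volume_cube_ne_top c hl
  rw [meanOsc, setLAverage_eq, setLAverage_eq, ← hb]
  have : ∫⁻ x in cube c l, ‖f x‖ₑ ≤ ‖b‖ₑ * volume (cube c l) + ∫⁻ x in cube c l, ‖f x - b‖ₑ := by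
    rw [← setLIntegral_const, ← lintegral_add_left measurable_const]
    refine lintegral_mono fun x => ?_
    calc ‖f x‖ₑ = ‖b + (f x - b)‖ₑ := by ring_nf
      _ ≤ _ := enorm_add_le _ _
  calc _ ≤ (‖b‖ₑ * volume (cube c l) + ∫⁻ x in cube c l, ‖f x - b‖ₑ) / volume (cube c l) := by
        gcongr
    _ = _ := by rw [ENNReal.add_div, ENNReal.mul_div_cancel_right h0 ht]

/-- Enlarging the domain of integration of `|f - b|` costs only the volume ratio `2 ^ n`. -/
theorem enorm_setAverage_sub_le {c d : EuclideanSpace ℝ (Fin n)} {l : ℝ} (hl : 0 < l)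
    (hsub : cube c l ⊆ cube d (2 * l)) (hf : IntegrableOn f (cube d (2 * l))) :
    ‖(⨍ x in cube c l, f x) - ⨍ x in cube d (2 * l), f x‖ₑ ≤
      2 ^ n * meanOsc f (cube d (2 * l)) := by
  set b := ⨍ x in cube d (2 * l), f x with hb
  have h0 := volume_cube_ne_zero c hl
  have ht := volume_cube_ne_top c hl
  have hfin : IsFiniteMeasure (volume.restrict (cube c l)) := ⟨by simpa using ht.lt_top⟩
  have hvol : volume (cube d (2 * l)) = 2 ^ n * volume (cube c l) := by
    rw [volume_cube c hl, volume_cube d (by positivity : 0 < 2 * l), mul_pow,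
      ENNReal.ofReal_mul (by positivity), ENNReal.ofReal_pow (by norm_num)]
    simp
  have h1 : (⨍ x in cube c l, f x) - b = ⨍ x in cube c l, (f x - b) := by
    have hI : Integrable f (volume.restrict (cube c l)) := hf.mono_set hsub
    rw [setAverage_eq, setAverage_eq, integral_sub hI (integrable_const b)]
    simp only [integral_const, smul_eq_mul, measureReal_restrict_apply_univ]
    have : volume.real (cube c l) ≠ 0 := (ENNReal.toReal_pos h0 ht).ne'
    field_simp
  rw [h1, setAverage_eq, enorm_smul]
  have h2 : ‖(volume.real (cube c l))⁻¹‖ₑ = (volume (cube c l))⁻¹ := by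
    have h3 : volume.real (cube c l) ≠ 0 := (ENNReal.toReal_pos h0 ht).ne'
    rw [enorm_inv h3, Measure.real, Real.enorm_eq_ofReal (by positivity),
      ENNReal.ofReal_toReal ht]
  rw [h2, meanOsc, ← hb, setLAverage_eq, hvol]
  calc (volume (cube c l))⁻¹ * ‖∫ x in cube c l, (f x - b)‖ₑ
      ≤ (volume (cube c l))⁻¹ * ∫⁻ x in cube d (2 * l), ‖f x - b‖ₑ := by
        gcongr
        exact (enorm_integral_le_lintegral_enorm _).trans (lintegral_mono_set hsub)
    _ = _ := by
        rw [div_eq_mul_inv, ENNReal.mul_inv (by simp) (by simp)]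
        set I := ∫⁻ x in cube d (2 * l), ‖f x - b‖ₑ
        rw [mul_comm _ I, mul_left_comm, ← mul_assoc (2 ^ n : ℝ≥0∞),
          ENNReal.mul_inv_cancel (by simp) (by simp), one_mul]

/-- Telescoping along a chain of cubes with doubling side lengths. -/
theorem enorm_setAverage_sub_le_sum {c : ℕ → EuclideanSpace ℝ (Fin n)} {l : ℝ} (hl : 0 < l) (J : ℕ)
    (hsub : ∀ j < J, cube (c j) (2 ^ j * l) ⊆ cube (c (j + 1)) (2 ^ (j + 1) * l))
    (hf : ∀ j ≤ J, IntegrableOn f (cube (c j) (2 ^ j * l))) :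
    ‖(⨍ x in cube (c 0) l, f x) - ⨍ x in cube (c J) (2 ^ J * l), f x‖ₑ ≤
      2 ^ n * ∑ j ∈ Finset.range J, meanOsc f (cube (c (j + 1)) (2 ^ (j + 1) * l)) := by
  induction J with
  | zero => simp
  | succ J ih =>
    have h1 := ih (fun j hj => hsub j (by omega)) (fun j hj => hf j (by omega))
    have e : (2 : ℝ) ^ (J + 1) * l = 2 * (2 ^ J * l) := by ring
    have hs := hsub J (by omega)
    have hi := hf (J + 1) le_rfl
    rw [e] at hs hi
    have h2 := enorm_setAverage_sub_le (f := f) (by positivity : 0 < 2 ^ J * l) hs hi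
    rw [← e] at h2
    rw [Finset.sum_range_succ, mul_add]
    calc _ = ‖((⨍ x in cube (c 0) l, f x) - ⨍ x in cube (c J) (2 ^ J * l), f x) +
          ((⨍ x in cube (c J) (2 ^ J * l), f x) -
            ⨍ x in cube (c (J + 1)) (2 ^ (J + 1) * l), f x)‖ₑ := by congr 1; ring
      _ ≤ _ := (enorm_add_le _ _).trans (add_le_add h1 h2)

theorem meanOsc_le_of_volume_mul_le (hp : 1 < p) {c : EuclideanSpace ℝ (Fin n)} {l : ℝ}
    (hl : 0 < l) {ε : ℝ≥0∞}
    (h : volume (cube c l) * meanOsc f (cube c l) ^ p ≤ ε ^ p) :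
    meanOsc f (cube c l) ≤ ε * ENNReal.ofReal (l ^ (-(n / p) : ℝ)) := by
  have hp0 : 0 < p := by linarith
  have h0 := volume_cube_ne_zero c hl
  have ht := volume_cube_ne_top c hl
  have h1 : meanOsc f (cube c l) ^ p ≤ (ε * ENNReal.ofReal (l ^ (-(n / p) : ℝ))) ^ p := by
    rw [ENNReal.mul_rpow_of_nonneg _ _ hp0.le, ENNReal.ofReal_rpow_of_pos (by positivity),
      ← Real.rpow_mul hl.le]
    have e : (-(n / p) : ℝ) * p = -(n : ℝ) := by field_simp
    rw [e, Real.rpow_neg hl.le, Real.rpow_natCast, ENNReal.ofReal_inv_of_pos (by positivity),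
      ← volume_cube c hl, ← div_eq_mul_inv, ENNReal.le_div_iff_mul_le (Or.inl h0) (Or.inl ht),
      mul_comm]
    exact h
  exact (ENNReal.rpow_le_rpow_iff hp0).1 h1

theorem volume_rpow_mul_setLAverage (g : EuclideanSpace ℝ (Fin n) → ℝ≥0∞)
    (c : EuclideanSpace ℝ (Fin n)) {l : ℝ} (hl : 0 < l) :
    volume (cube c l) ^ (1 / p) * (⨍⁻ x in cube c l, g x ∂volume) =
      ENNReal.ofReal (l ^ (-(n - n / p) : ℝ)) * ∫⁻ x in cube c l, g x := by
  have e : (-(n - n / p) : ℝ) = n * (1 / p) + -n := by ring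
  rw [setLAverage_eq, volume_cube c hl, ENNReal.div_eq_inv_mul, ← mul_assoc, e,
    Real.rpow_add hl, ENNReal.ofReal_mul (by positivity), Real.rpow_neg hl.le, Real.rpow_natCast,
    ENNReal.ofReal_inv_of_pos (by positivity), ENNReal.ofReal_rpow_of_pos (by positivity),
    Real.rpow_mul hl.le, Real.rpow_natCast]

/-- Given a filter, cubes that are contained in a suitable member of the filter, and whose
complements belong to the filter, have small mean oscillation. -/
theorem MemJN.exists_mem_filter (hp : 1 < p) (hf : MemJN p X f)
    (F : Filter (EuclideanSpace ℝ (Fin n))) {η : ℝ≥0∞} (hη : η ≠ 0) :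
    ∃ U ∈ F, ∀ T, IsCube T → T ⊆ X → T ⊆ U → Tᶜ ∈ F → volume T * meanOsc f T ^ p ≤ η := by
  by_contra! hcon
  obtain ⟨T, hT, hd⟩ := exists_seq_of_forall_finset_exists
    (fun T : Set (EuclideanSpace ℝ (Fin n)) =>
      IsCube T ∧ T ⊆ X ∧ Tᶜ ∈ F ∧ η < volume T * meanOsc f T ^ p)
    (fun S T => Disjoint S T) (by
      intro s hs
      -- The complements of the finitely many cubes already chosen lie in `F`, so the next bad cube
      -- can be taken disjoint from all of them.
      have hU : (⋂ S ∈ s, Sᶜ) ∈ F := (biInter_finset_mem s).2 fun S hS => (hs S hS).2.2.1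
      obtain ⟨T, h1, h2, h3, h4, h5⟩ := hcon _ hU
      refine ⟨T, ⟨h1, h2, h4, h5⟩, fun S hS => ?_⟩
      have := h3.trans (Set.biInter_subset_of_mem hS)
      exact (Set.disjoint_left.2 fun x hx => this hx).symm)
  have hpair : Pairwise (Function.onFun Disjoint T) := by
    intro i j hij
    rcases lt_or_gt_of_ne hij with h | h
    · exact hd _ _ h
    · exact (hd _ _ h).symm
  -- The defining sum runs over a set of cubes, so the sequence must not repeat; disjoint cubes of
  -- positive volume are distinct.
  have hinj : Function.Injective T := by
    intro i j hij
    by_contra hne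
    have := hpair hne
    rw [Function.onFun, ← hij, disjoint_self] at this
    obtain ⟨c, l, hl, hc⟩ := (hT i).1
    have h0 := volume_cube_ne_zero c hl
    rw [← hc, this] at h0
    simp at h0
  obtain ⟨-, K, hK⟩ := hf
  have h := hK (Set.range T) (Set.countable_range T)
    (by rintro _ ⟨i, rfl⟩; exact ⟨(hT i).1, (hT i).2.1⟩)
    ((Set.pairwiseDisjoint_range_iff).2 fun i j hij => hpair fun h => hij (by rw [h]))
  rw [tsum_range (fun Q => volume Q * meanOsc f Q ^ p) hinj] at h
  have h2 : ∑' _ : ℕ, η ≤ ∑' i, volume (T i) * meanOsc f (T i) ^ p :=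
    ENNReal.tsum_le_tsum fun i => (hT i).2.2.2.le
  rw [ENNReal.tsum_const_eq_top_of_ne_zero hη] at h2
  exact ENNReal.rpow_ne_top_of_nonneg (by linarith : 0 ≤ p) (ENNReal.coe_ne_top (r := K))
    (top_le_iff.1 (h2.trans h))

/-- The geometric constant of the telescoping estimate. -/
noncomputable def chainConst (n : ℕ) (p : ℝ) : ℝ≥0∞ :=
  2 ^ n * (1 - ENNReal.ofReal (2 ^ (-(n / p) : ℝ)))⁻¹

theorem chainConst_ne_top (hn : 1 ≤ n) (hp : 1 < p) : chainConst n p ≠ ∞ := by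
  refine ENNReal.mul_ne_top (by simp) (ENNReal.inv_ne_top.2 ?_)
  refine (tsub_pos_of_lt ?_).ne'
  rw [ENNReal.ofReal_lt_one]
  refine Real.rpow_lt_one_of_one_lt_of_neg (by norm_num) ?_
  have : (0 : ℝ) < n := by exact_mod_cast hn
  have : 0 < n / p := by positivity
  linarith

theorem chainConst_ne_zero : chainConst n p ≠ 0 := by
  refine mul_ne_zero (by simp) (ENNReal.inv_ne_zero.2 ?_)
  exact ne_top_of_le_ne_top ENNReal.one_ne_top tsub_le_self

/-- Doubling the side multiplies the bound on the oscillation by `2 ^ (-n/p)`, so a geometric series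
bounds the sum, uniformly in `J`. -/
theorem sum_meanOsc_le (hp : 1 < p) {c : ℕ → EuclideanSpace ℝ (Fin n)} {l : ℝ} (hl : 0 < l)
    (J : ℕ) {ε : ℝ≥0∞}
    (hε : ∀ j < J, volume (cube (c j) (2 ^ j * l)) * meanOsc f (cube (c j) (2 ^ j * l)) ^ p ≤
      ε ^ p) :
    2 ^ n * ∑ j ∈ Finset.range J, meanOsc f (cube (c j) (2 ^ j * l)) ≤
      chainConst n p * ε * ENNReal.ofReal (l ^ (-(n / p) : ℝ)) := by
  set q := ENNReal.ofReal (2 ^ (-(n / p) : ℝ)) with hq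
  have h1 : ∀ j ∈ Finset.range J, meanOsc f (cube (c j) (2 ^ j * l)) ≤
      q ^ j * (ε * ENNReal.ofReal (l ^ (-(n / p) : ℝ))) := by
    intro j hj
    refine (meanOsc_le_of_volume_mul_le hp (by positivity) (hε j (Finset.mem_range.1 hj))).trans_eq ?_
    rw [Real.mul_rpow (by positivity) hl.le, ENNReal.ofReal_mul (by positivity), hq,
      ← ENNReal.ofReal_pow (by positivity), ← Real.rpow_natCast, ← Real.rpow_natCast,
      ← Real.rpow_mul (by norm_num), ← Real.rpow_mul (by norm_num), mul_comm (j : ℝ)]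
    ring
  calc _ ≤ 2 ^ n * ∑ j ∈ Finset.range J, q ^ j * (ε * ENNReal.ofReal (l ^ (-(n / p) : ℝ))) := by
        gcongr with j hj; exact h1 j hj
    _ ≤ 2 ^ n * ((1 - q)⁻¹ * (ε * ENNReal.ofReal (l ^ (-(n / p) : ℝ)))) := by
        rw [← Finset.sum_mul, ← ENNReal.tsum_geometric]
        gcongr
        exact ENNReal.sum_le_tsum _
    _ = _ := by rw [chainConst, ← hq]; ring

theorem enorm_setAverage_sub_le_chainConst (hp : 1 < p) {c : ℕ → EuclideanSpace ℝ (Fin n)} {l : ℝ}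
    (hl : 0 < l) (J : ℕ)
    (hsub : ∀ j < J, cube (c j) (2 ^ j * l) ⊆ cube (c (j + 1)) (2 ^ (j + 1) * l))
    (hf : ∀ j ≤ J, IntegrableOn f (cube (c j) (2 ^ j * l))) {ε : ℝ≥0∞}
    (hε : ∀ j ≤ J, volume (cube (c j) (2 ^ j * l)) * meanOsc f (cube (c j) (2 ^ j * l)) ^ p ≤
      ε ^ p) :
    ‖(⨍ x in cube (c 0) l, f x) - ⨍ x in cube (c J) (2 ^ J * l), f x‖ₑ ≤
      chainConst n p * ε * ENNReal.ofReal (l ^ (-(n / p) : ℝ)) := by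
  refine (enorm_setAverage_sub_le_sum hl J hsub hf).trans
    (le_trans ?_ (sum_meanOsc_le hp hl (J + 1) fun j hj => hε j (by omega)))
  rw [Finset.sum_range_succ']
  gcongr
  exact le_self_add

/-- The average over a cube is controlled by the oscillations along a chain of doubling cubes and
the average over the last cube. -/
theorem rpow_mul_lintegral_le_chain (hp : 1 < p) {c : ℕ → EuclideanSpace ℝ (Fin n)} {l : ℝ}
    (hl : 0 < l) (J : ℕ)
    (hsub : ∀ j < J, cube (c j) (2 ^ j * l) ⊆ cube (c (j + 1)) (2 ^ (j + 1) * l))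
    (hf : ∀ j ≤ J, IntegrableOn f (cube (c j) (2 ^ j * l))) {ε : ℝ≥0∞}
    (hε : ∀ j ≤ J, volume (cube (c j) (2 ^ j * l)) * meanOsc f (cube (c j) (2 ^ j * l)) ^ p ≤
      ε ^ p) :
    ENNReal.ofReal (l ^ (-(n - n / p) : ℝ)) * ∫⁻ x in cube (c 0) l, ‖f x‖ₑ ≤
      ENNReal.ofReal (l ^ (n / p : ℝ)) * ‖⨍ x in cube (c J) (2 ^ J * l), f x‖ₑ +
        chainConst n p * ε := by
  have h1 := sum_meanOsc_le hp hl (J + 1) fun j hj => hε j (by omega)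
  -- The telescoping sum starts at the second cube; the term `j = 0` pays for replacing `|f|` by the
  -- average over the first cube.
  rw [Finset.sum_range_succ', mul_add] at h1
  have h2 := enorm_setAverage_sub_le_sum hl J hsub hf
  have h3 := setLAverage_enorm_le (f := f) (c 0) hl
  have h4 : (⨍⁻ x in cube (c 0) l, ‖f x‖ₑ ∂volume) ≤ ‖⨍ x in cube (c J) (2 ^ J * l), f x‖ₑ +
      chainConst n p * ε * ENNReal.ofReal (l ^ (-(n / p) : ℝ)) := by
    refine h3.trans ?_
    have h5 : ‖⨍ x in cube (c 0) l, f x‖ₑ ≤ ‖⨍ x in cube (c J) (2 ^ J * l), f x‖ₑ +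
        ‖(⨍ x in cube (c 0) l, f x) - ⨍ x in cube (c J) (2 ^ J * l), f x‖ₑ := by
      refine le_trans (le_of_eq ?_) (enorm_add_le _ _)
      congr 1; ring
    have h6 : meanOsc f (cube (c 0) l) ≤ 2 ^ n * meanOsc f (cube (c 0) (2 ^ 0 * l)) := by
      rw [pow_zero, one_mul]
      exact le_mul_of_one_le_left' (one_le_pow₀ one_le_two)
    calc _ ≤ _ := add_le_add h5 h6
      _ ≤ _ := by
        rw [add_assoc]
        gcongr
        exact (add_le_add_left h2 _).trans h1
  rw [← volume_rpow_mul_setLAverage _ _ hl]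
  have h7 : volume (cube (c 0) l) ^ (1 / p) = ENNReal.ofReal (l ^ (n / p : ℝ)) := by
    rw [volume_cube _ hl, ENNReal.ofReal_rpow_of_pos (by positivity), ← Real.rpow_natCast,
      ← Real.rpow_mul hl.le]
    congr 2; ring
  rw [h7]
  refine (mul_le_mul_right h4 _).trans (le_of_eq ?_)
  rw [mul_add]
  congr 1
  rw [mul_comm, mul_assoc, ← ENNReal.ofReal_mul (by positivity), ← Real.rpow_add hl]
  simp

/-! ### Tools for the limiting arguments -/

theorem exists_cube_subset_of_mem_nhds {x₀ : EuclideanSpace ℝ (Fin n)}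
    {U : Set (EuclideanSpace ℝ (Fin n))} (hU : U ∈ 𝓝 x₀) : ∃ ρ > 0, cube x₀ (2 * ρ) ⊆ U := by
  have hc : Continuous (fun y : Fin n → ℝ => (WithLp.toLp 2 y : EuclideanSpace ℝ (Fin n))) :=
    PiLp.continuous_toLp 2 _
  have h : (fun y : Fin n → ℝ => (WithLp.toLp 2 y : EuclideanSpace ℝ (Fin n))) ⁻¹' U ∈
      𝓝 (fun i => x₀ i) := hc.continuousAt.preimage_mem_nhds hU
  obtain ⟨ρ, hρ, hsub⟩ := Metric.mem_nhds_iff.1 h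
  refine ⟨ρ, hρ, fun x hx => ?_⟩
  have : (fun i => x i) ∈ Metric.ball (fun i => x₀ i) ρ := by
    rw [Metric.mem_ball, dist_pi_lt_iff hρ]
    intro i
    have := hx i
    rw [Real.dist_eq]
    linarith
  exact hsub this

theorem cube_mem_nhds (x₀ : EuclideanSpace ℝ (Fin n)) {r : ℝ} (hr : 0 < r) :
    cube x₀ r ∈ 𝓝 x₀ :=
  (isOpen_cube x₀ r).mem_nhds fun i => by simpa using hr

/-- Monotone convergence over concentric cubes. It admits cubes whose closure contains `x₀`, to
which the filter argument does not apply directly. -/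
theorem lintegral_cube_le_of_forall_lt {g : EuclideanSpace ℝ (Fin n) → ℝ≥0∞} {s : ℝ} (hs : 0 ≤ s)
    {c : EuclideanSpace ℝ (Fin n)} {l : ℝ} (hl : 0 < l) {δ : ℝ≥0∞}
    (h : ∀ l', 0 < l' → l' < l → ENNReal.ofReal (l' ^ (-s)) * ∫⁻ x in cube c l', g x ≤ δ) :
    ENNReal.ofReal (l ^ (-s)) * ∫⁻ x in cube c l, g x ≤ δ := by
  -- The `2` in the denominator keeps `u 0 = l / 2` positive.
  set u : ℕ → ℝ := fun k => l * (1 - 1 / ((k : ℝ) + 2)) with hu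
  have hk : ∀ k : ℕ, 1 / ((k : ℝ) + 2) < 1 := fun k => by
    rw [div_lt_one (by positivity)]; linarith [k.cast_nonneg (α := ℝ)]
  have hk' : ∀ k : ℕ, 0 < 1 / ((k : ℝ) + 2) := fun k => by positivity
  have hu0 : ∀ k, 0 < u k := fun k => mul_pos hl (by linarith [hk k])
  have hul : ∀ k, u k < l := fun k => by
    have := mul_pos hl (hk' k)
    simp only [hu]; linarith
  have hmono : Monotone u := by
    intro a b hab
    simp only [hu]
    gcongr
  have hlim : Tendsto u atTop (𝓝 l) := by
    have h1 : Tendsto (fun k : ℕ => 1 / ((k : ℝ) + 2)) atTop (𝓝 0) := by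
      simp only [one_div]
      exact tendsto_inv_atTop_zero.comp
        (tendsto_atTop_add_const_right _ _ tendsto_natCast_atTop_atTop)
    have h2 := (h1.const_sub 1).const_mul l
    rwa [sub_zero, mul_one] at h2
  have hcm : Monotone fun k => cube c (u k) := by
    intro a b hab x hx i
    have := hx i
    have := hmono hab
    linarith
  have hU : cube c l = ⋃ k, cube c (u k) := by
    refine Set.Subset.antisymm (fun x hx => ?_) (Set.iUnion_subset fun k x hx i => ?_)
    · have : ∀ᶠ k in atTop, ∀ i, |x i - c i| < u k / 2 :=
        eventually_all.2 fun i => (hlim.div_const 2).eventually_const_lt (hx i)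
      obtain ⟨k, hk⟩ := this.exists
      exact Set.mem_iUnion.2 ⟨k, hk⟩
    · have := hx i
      have := hul k
      linarith
  rw [hU, setLIntegral_iUnion_of_directed _ hcm.directed_le, ENNReal.mul_iSup]
  refine iSup_le fun k => le_trans ?_ (h (u k) (hu0 k) (hul k))
  gcongr ENNReal.ofReal ?_ * _
  exact Real.rpow_le_rpow_of_nonpos (hu0 k) (hul k).le (by linarith)

theorem enorm_setAverage_le (g : EuclideanSpace ℝ (Fin n) → ℝ) {c : EuclideanSpace ℝ (Fin n)}
    {l m : ℝ} (hm : 0 < m) (hml : m ≤ l) {B : Set (EuclideanSpace ℝ (Fin n))} (hB : cube c l ⊆ B) :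
    ‖⨍ x in cube c l, g x‖ₑ ≤ (ENNReal.ofReal (m ^ n))⁻¹ * ∫⁻ x in B, ‖g x‖ₑ := by
  have hl : 0 < l := hm.trans_le hml
  have h0 := volume_cube_ne_zero c hl
  have ht := volume_cube_ne_top c hl
  have h3 : volume.real (cube c l) ≠ 0 := (ENNReal.toReal_pos h0 ht).ne'
  rw [setAverage_eq, enorm_smul, enorm_inv h3, Measure.real, Real.enorm_eq_ofReal (by positivity),
      ENNReal.ofReal_toReal ht, volume_cube c hl]
  gcongr
  exact (enorm_integral_le_lintegral_enorm _).trans (lintegral_mono_set hB)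

theorem exists_pow_mul_mem_Ioc {l ρ : ℝ} (hl : 0 < l) (h : l ≤ ρ) :
    ∃ J : ℕ, 2 ^ J * l ≤ ρ ∧ ρ / 2 < 2 ^ J * l := by
  obtain ⟨J, h1, h2⟩ := exists_nat_pow_near ((one_le_div hl).2 h) one_lt_two
  rw [le_div_iff₀ hl] at h1
  rw [div_lt_iff₀ hl, pow_succ] at h2
  exact ⟨J, h1, by linarith⟩

theorem exists_chainConst_mul_le (hn : 1 ≤ n) (hp : 1 < p) {δ : ℝ≥0∞} (hδ : δ ≠ 0) :
    ∃ ε : ℝ≥0∞, ε ^ p ≠ 0 ∧ chainConst n p * ε ≤ δ / 2 := by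
  refine ⟨δ / 2 / chainConst n p, ?_, ?_⟩
  · have h1 : δ / 2 / chainConst n p ≠ 0 := by
      simp [hδ, chainConst_ne_top hn hp, ENNReal.div_eq_zero_iff]
    rw [Ne, ENNReal.rpow_eq_zero_iff]
    rintro (⟨h, -⟩ | ⟨-, h⟩)
    · exact h1 h
    · linarith
  · rw [ENNReal.mul_div_cancel chainConst_ne_zero (chainConst_ne_top hn hp)]

theorem eventually_ofReal_rpow_mul_le (hn : 1 ≤ n) (hp : 1 < p) {D δ : ℝ≥0∞} (hD : D ≠ ∞)
    (hδ : δ ≠ 0) : ∀ᶠ t in 𝓝[>] (0 : ℝ), ENNReal.ofReal (t ^ (n / p : ℝ)) * D ≤ δ := by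
  have hnp : 0 < (n / p : ℝ) := by
    have : (0 : ℝ) < n := by exact_mod_cast hn
    positivity
  have h1 : Tendsto (fun t : ℝ => ENNReal.ofReal (t ^ (n / p : ℝ)) * D) (𝓝[>] 0) (𝓝 0) := by
    have h2 : Tendsto (fun t : ℝ => t ^ (n / p : ℝ)) (𝓝[>] 0) (𝓝 0) := by
      have := (Real.continuousAt_rpow_const 0 (n / p : ℝ) (Or.inr hnp.le)).tendsto
      rw [Real.zero_rpow hnp.ne'] at this
      exact this.mono_left nhdsWithin_le_nhds
    have h3 := ENNReal.Tendsto.mul_const (ENNReal.tendsto_ofReal h2) (b := D) (Or.inr hD)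
    simpa using h3
  exact (h1.eventually_lt_const (pos_iff_ne_zero.2 hδ)).mono fun t ht => ht.le

/-! ### Small cubes near a point -/

/-- The vector `c + t σ`, for a vector of signs `σ`. -/
noncomputable def shift (c : EuclideanSpace ℝ (Fin n)) (σ : Fin n → ℝ) (t : ℝ) :
    EuclideanSpace ℝ (Fin n) :=
  WithLp.toLp 2 fun i => c i + σ i * t

@[simp]
theorem shift_apply (c : EuclideanSpace ℝ (Fin n)) (σ : Fin n → ℝ) (t : ℝ) (i : Fin n) :
    shift c σ t i = c i + σ i * t := rfl

theorem abs_sub_le_of_sign {s a b t l : ℝ} (hs : s = 1 ∨ s = -1) (h1 : l / 2 ≤ s * (a - b))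
    (h2 : s * (a - b) ≤ t - l / 2) : |a - (b + s * (t / 2))| ≤ (t - l) / 2 := by
  rw [abs_le]
  rcases hs with rfl | rfl <;> constructor <;> linarith

theorem rpow_neg_exponent_nonneg (hp : 1 < p) : (0 : ℝ) ≤ n - n / p := by
  rw [sub_nonneg]
  exact div_le_self n.cast_nonneg hp.le

/-- Small cubes in a given orthant at `x₀`. -/
theorem MemJN.eventually_orthant (hn : 1 ≤ n) (hp : 1 < p) (hf : MemJN p X f)
    {x₀ : EuclideanSpace ℝ (Fin n)} {σ : Fin n → ℝ} (hσ : ∀ i, σ i = 1 ∨ σ i = -1) {r : ℝ}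
    (hr : 0 < r) (hX : cube (shift x₀ σ (r / 2)) r ⊆ X) {δ : ℝ≥0∞} (hδ : δ ≠ 0) :
    ∀ᶠ t in 𝓝[>] (0 : ℝ), ∀ (c : EuclideanSpace ℝ (Fin n)) (l : ℝ), 0 < l →
      (∀ i, l / 2 ≤ σ i * (c i - x₀ i) ∧ σ i * (c i - x₀ i) ≤ t - l / 2) →
      ENNReal.ofReal (l ^ (-(n - n / p) : ℝ)) * ∫⁻ x in cube c l, ‖f x‖ₑ ≤ δ := by
  obtain ⟨ε, hε, hεδ⟩ := exists_chainConst_mul_le hn hp hδ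
  obtain ⟨U, hU, hUN⟩ := hf.exists_mem_filter hp (𝓝 x₀) hε
  obtain ⟨ρ, hρ, hρU⟩ := exists_cube_subset_of_mem_nhds hU
  set r₁ := min r ρ with hr₁
  have hr₁0 : 0 < r₁ := lt_min hr hρ
  have hr₁r : r₁ ≤ r := min_le_left _ _
  have hr₁ρ : r₁ ≤ ρ := min_le_right _ _
  -- Chains stop at a side in `(r₁ / 4, r₁ / 2]`, so `D` bounds every terminal average independently
  -- of the starting cube.
  set D := (ENNReal.ofReal ((r₁ / 2 / 2) ^ n))⁻¹ *
    ∫⁻ x in cube (shift x₀ σ (r / 2)) r, ‖f x‖ₑ with hD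
  have hDt : D ≠ ∞ := by
    refine ENNReal.mul_ne_top (ENNReal.inv_ne_top.2 ?_) (hf.integrableOn_cube hp hr hX).2.ne
    rw [Ne, ENNReal.ofReal_eq_zero, not_le]
    positivity
  have hδ2 : δ / 2 ≠ 0 := by simp [ENNReal.div_eq_zero_iff, hδ]
  have hpos : (0 : ℝ) ≤ n / p := by positivity
  filter_upwards [eventually_ofReal_rpow_mul_le hn hp hDt hδ2, self_mem_nhdsWithin,
    mem_nhdsWithin_of_mem_nhds (Iio_mem_nhds (by positivity : 0 < r₁ / 2))] with t ht ht0 htr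
  simp only [Set.mem_Ioi, Set.mem_Iio] at ht0 htr
  intro c l hl hc
  refine lintegral_cube_le_of_forall_lt (rpow_neg_exponent_nonneg hp) hl fun m hm hml => ?_
  let i₀ : Fin n := ⟨0, hn⟩
  have hlt : l ≤ t := by linarith [(hc i₀).1, (hc i₀).2]
  obtain ⟨J, hJ1, hJ2⟩ := exists_pow_mul_mem_Ioc hm (by linarith : m ≤ r₁ / 2)
  -- The faces towards `x₀` stay fixed while the cube doubles in the direction `σ`. Starting from
  -- side `m < l` keeps them strictly off the hyperplanes through `x₀`.
  set C : ℕ → EuclideanSpace ℝ (Fin n) := fun j => shift c σ ((2 ^ j - 1) * m / 2) with hC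
  have hC0 : C 0 = c := by ext i; simp [hC]
  have hCσ : ∀ j i, σ i * (C j i - x₀ i) = σ i * (c i - x₀ i) + (2 ^ j - 1) * m / 2 := by
    intro j i
    simp only [hC, shift_apply]
    rcases hσ i with h | h <;> rw [h] <;> ring
  have hle : ∀ j ≤ J, (2 : ℝ) ^ j * m ≤ r₁ / 2 := fun j hj => by
    have : (2 : ℝ) ^ j ≤ 2 ^ J := pow_le_pow_right₀ (by norm_num) hj
    exact (mul_le_mul_of_nonneg_right this hm.le).trans hJ1
  -- Half of `r₁` is reserved for the extent `t` of the starting cube, half for the largest side.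
  -- Taking `r' = r` gives inclusion in `X`, and `r' = r₁` gives inclusion in `U`.
  have hbox : ∀ j ≤ J, ∀ r' ≥ r₁,
      cube (C j) (2 ^ j * m) ⊆ cube (shift x₀ σ (r' / 2)) r' := by
    intro j hj r' hr'
    refine cube_subset_cube fun i => ?_
    show |C j i - (x₀ i + σ i * (r' / 2))| ≤ _
    have h1 := hle j hj
    refine abs_sub_le_of_sign (hσ i) ?_ ?_ <;> rw [hCσ] <;>
      linarith [(hc i).1, (hc i).2]
  have hCX : ∀ j ≤ J, cube (C j) (2 ^ j * m) ⊆ X := fun j hj => (hbox j hj r hr₁r).trans hX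
  have hCU : ∀ j ≤ J, cube (C j) (2 ^ j * m) ⊆ U := fun j hj => by
    refine ((hbox j hj r₁ le_rfl).trans (cube_subset_cube fun i => ?_)).trans hρU
    rw [shift_apply, abs_le]
    rcases hσ i with h | h <;> rw [h] <;> constructor <;> linarith
  have hCc : ∀ j, (cube (C j) (2 ^ j * m))ᶜ ∈ 𝓝 x₀ := fun j => by
    have ho : IsOpen {x : EuclideanSpace ℝ (Fin n) | σ i₀ * (C j i₀ - x i₀) > 2 ^ j * m / 2} :=
      isOpen_lt continuous_const (by fun_prop)
    refine mem_of_superset (ho.mem_nhds ?_) ?_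
    · show σ i₀ * (C j i₀ - x₀ i₀) > 2 ^ j * m / 2
      rw [hCσ]
      linarith [(hc i₀).1]
    · intro x hx hxc
      have h1 : σ i₀ * (C j i₀ - x i₀) > 2 ^ j * m / 2 := hx
      have h2 := abs_lt.1 (hxc i₀)
      rcases hσ i₀ with h | h <;> rw [h] at h1 <;> linarith [h2.1, h2.2]
  have key := rpow_mul_lintegral_le_chain (f := f) (c := C) hp hm J
    (fun j _ => cube_subset_cube fun i => by
      simp only [hC, shift_apply, pow_succ, abs_le]
      rcases hσ i with h | h <;> rw [h] <;> constructor <;> nlinarith [pow_pos (two_pos (α := ℝ)) j])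
    (fun j hj => hf.integrableOn_cube hp (by positivity) (hCX j hj)) (ε := ε)
    (fun j hj => hUN _ ⟨_, _, by positivity, rfl⟩ (hCX j hj) (hCU j hj) (hCc j))
  rw [hC0] at key
  refine key.trans ?_
  rw [← ENNReal.add_halves δ]
  refine add_le_add (le_trans ?_ ht) hεδ
  gcongr
  · linarith
  · exact enorm_setAverage_le f (by positivity) hJ2.le (hbox J le_rfl r hr₁r)

/-- Around `x₀`, the set `X` fills every open orthant that it meets. -/
def FillsOrthants (X : Set (EuclideanSpace ℝ (Fin n))) (x₀ : EuclideanSpace ℝ (Fin n)) : Prop :=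
  ∃ r > 0, ∀ σ : Fin n → ℝ, (∀ i, σ i = 1 ∨ σ i = -1) →
    (∃ x ∈ X, ∀ i, 0 < σ i * (x i - x₀ i)) → cube (shift x₀ σ (r / 2)) r ⊆ X

theorem fillsOrthants_univ (x₀ : EuclideanSpace ℝ (Fin n)) : FillsOrthants Set.univ x₀ :=
  ⟨1, one_pos, fun _ _ _ => Set.subset_univ _⟩

/-- Take `r` below every positive distance from `x₀` to a face. At distance zero, an orthant
pointing out through that face does not meet the cube. Boundary points are allowed, as compactness
needs the closed cube. -/
theorem fillsOrthants_cube {z x₀ : EuclideanSpace ℝ (Fin n)} {L : ℝ}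
    (hx₀ : ∀ i, |x₀ i - z i| ≤ L / 2) : FillsOrthants (cube z L) x₀ := by
  have h1 : ∀ w : ℝ, ∀ᶠ r in 𝓝[>] (0 : ℝ), 0 < w → r ≤ w := fun w => by
    by_cases hw : 0 < w
    · filter_upwards [mem_nhdsWithin_of_mem_nhds (Iio_mem_nhds hw)] with r hr _
      exact le_of_lt hr
    · exact Eventually.of_forall fun r h => absurd h hw
  have h2 : ∀ᶠ r in 𝓝[>] (0 : ℝ), ∀ i, (0 < z i - x₀ i + L / 2 → r ≤ z i - x₀ i + L / 2) ∧
      (0 < x₀ i - z i + L / 2 → r ≤ x₀ i - z i + L / 2) :=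
    eventually_all.2 fun i => (h1 _).and (h1 _)
  obtain ⟨r, hr, hr0⟩ := (h2.and self_mem_nhdsWithin).exists
  refine ⟨r, hr0, fun σ hσ ⟨x, hx, hxσ⟩ => cube_subset_cube fun i => ?_⟩
  have a1 := abs_lt.1 (hx i)
  have a2 := abs_le.1 (hx₀ i)
  have a3 := hxσ i
  rw [shift_apply, abs_le]
  rcases hσ i with h | h <;> rw [h] at a3 ⊢
  · have := (hr i).1 (by linarith)
    constructor <;> linarith
  · have := (hr i).2 (by linarith)
    constructor <;> linarith

/-- The sign vector that belongs to a subset of the coordinates. -/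
def signs (b : Fin n → Bool) (i : Fin n) : ℝ := if b i then 1 else -1

theorem signs_eq (b : Fin n → Bool) (i : Fin n) : signs b i = 1 ∨ signs b i = -1 := by
  unfold signs; split <;> simp

/-- Small cubes near `x₀`. -/
theorem MemJN.exists_near (hn : 1 ≤ n) (hp : 1 < p) (hf : MemJN p X f)
    {x₀ : EuclideanSpace ℝ (Fin n)} (hx₀ : FillsOrthants X x₀) {δ : ℝ≥0∞} (hδ : δ ≠ 0) :
    ∃ t > 0, ∀ (c : EuclideanSpace ℝ (Fin n)) (l : ℝ), 0 < l → l ≤ t → c ∈ cube x₀ t →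
      cube c l ⊆ X → ENNReal.ofReal (l ^ (-(n - n / p) : ℝ)) * ∫⁻ x in cube c l, ‖f x‖ₑ ≤ δ := by
  obtain ⟨r, hr, hrX⟩ := hx₀
  set N := Fintype.card (Fin n → Bool) with hN
  have hδN : δ / N ≠ 0 := by simp [ENNReal.div_eq_zero_iff, hδ]
  have hev : ∀ᶠ t in 𝓝[>] (0 : ℝ), ∀ b : Fin n → Bool,
      (∃ x ∈ X, ∀ i, 0 < signs b i * (x i - x₀ i)) →
      ∀ (c : EuclideanSpace ℝ (Fin n)) (l : ℝ), 0 < l →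
      (∀ i, l / 2 ≤ signs b i * (c i - x₀ i) ∧ signs b i * (c i - x₀ i) ≤ t - l / 2) →
      ENNReal.ofReal (l ^ (-(n - n / p) : ℝ)) * ∫⁻ x in cube c l, ‖f x‖ₑ ≤ δ / N := by
    refine eventually_all.2 fun b => ?_
    by_cases hb : ∃ x ∈ X, ∀ i, 0 < signs b i * (x i - x₀ i)
    · exact (hf.eventually_orthant hn hp (signs_eq b) hr (hrX _ (signs_eq b) hb) hδN).mono
        fun t ht _ => ht
    · exact Eventually.of_forall fun t h => absurd h hb
  obtain ⟨t, ht, ht0⟩ := (hev.and self_mem_nhdsWithin).exists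
  have ht0 : 0 < t := ht0
  refine ⟨t / 4, by positivity, fun c l hl hlt hc hcX => ?_⟩
  set O : (Fin n → Bool) → Set (EuclideanSpace ℝ (Fin n)) :=
    fun b => {x | ∀ i, 0 < signs b i * (x i - x₀ i)} with hO
  have hcover : cube c l ≤ᵐ[volume] ⋃ b, cube c l ∩ O b := by
    filter_upwards [ae_coord_ne x₀] with x hx hxc
    refine Set.mem_iUnion.2 ⟨fun i => decide (x₀ i < x i), hxc, fun i => ?_⟩
    simp only [signs, decide_eq_true_eq]
    split_ifs with h
    · linarith
    · have := lt_of_le_of_ne (not_lt.1 h) (hx i)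
      linarith
  have hpiece : ∀ b, ENNReal.ofReal (l ^ (-(n - n / p) : ℝ)) *
      ∫⁻ x in cube c l ∩ O b, ‖f x‖ₑ ≤ δ / N := by
    intro b
    by_cases hb : ∃ x ∈ cube c l, ∀ i, 0 < signs b i * (x i - x₀ i)
    · obtain ⟨x, hx, hxb⟩ := hb
      -- The centre is pushed into the orthant just far enough that the cube of the same side lies
      -- in it, while still covering the piece of the original cube there.
      set d : EuclideanSpace ℝ (Fin n) := WithLp.toLp 2 fun i =>
        x₀ i + signs b i * max (signs b i * (c i - x₀ i)) (l / 2) with hd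
      have hdσ : ∀ i, signs b i * (d i - x₀ i) = max (signs b i * (c i - x₀ i)) (l / 2) := by
        intro i
        have : d i = x₀ i + signs b i * max (signs b i * (c i - x₀ i)) (l / 2) := rfl
        rw [this]
        rcases signs_eq b i with h | h <;> rw [h] <;> ring
      refine le_trans ?_ (ht b ⟨x, hcX hx, hxb⟩ d l hl fun i => ?_)
      · gcongr
        rintro y ⟨hy, hyb⟩ i
        have h1 := abs_lt.1 (hy i)
        have h2 : 0 < signs b i * (y i - x₀ i) := hyb i
        have h3 := hdσ i
        rw [abs_lt]
        rcases max_cases (signs b i * (c i - x₀ i)) (l / 2) with h4 | h4 <;>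
          rw [h4.1] at h3 <;> rcases signs_eq b i with h | h <;> rw [h] at h2 h3 h4 <;>
          constructor <;> linarith [h1.1, h1.2, h4.2]
      · rw [hdσ]
        refine ⟨le_max_right _ _, max_le ?_ (by linarith)⟩
        have h1 := abs_lt.1 (hc i)
        rcases signs_eq b i with h | h <;> rw [h] <;> linarith [h1.1, h1.2]
    · have : cube c l ∩ O b = ∅ := by
        refine Set.eq_empty_of_forall_notMem fun x hx => hb ⟨x, hx.1, hx.2⟩
      rw [this]
      simp
  calc _ ≤ ENNReal.ofReal (l ^ (-(n - n / p) : ℝ)) *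
        ∑' b, ∫⁻ x in cube c l ∩ O b, ‖f x‖ₑ := by
        gcongr
        exact (lintegral_mono_set' hcover).trans (lintegral_iUnion_le _ _)
    _ = ∑ b, ENNReal.ofReal (l ^ (-(n - n / p) : ℝ)) * ∫⁻ x in cube c l ∩ O b, ‖f x‖ₑ := by
        rw [tsum_fintype, Finset.mul_sum]
    _ ≤ ∑ b : Fin n → Bool, δ / N := Finset.sum_le_sum fun b _ => hpiece b
    _ = δ := by
        rw [Finset.sum_const, Finset.card_univ, nsmul_eq_mul, ← hN, ENNReal.mul_div_cancel]
        · simp [hN]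
        · simp

/-! ### Compactness and bounded cubes -/

theorem MemJN.exists_near_of_isCompact (hn : 1 ≤ n) (hp : 1 < p) (hf : MemJN p X f)
    {S : Set (EuclideanSpace ℝ (Fin n))} (hS : IsCompact S) (hSX : ∀ x ∈ S, FillsOrthants X x)
    {δ : ℝ≥0∞} (hδ : δ ≠ 0) :
    ∃ t > 0, ∀ (c : EuclideanSpace ℝ (Fin n)) (l : ℝ), 0 < l → l ≤ t → c ∈ S →
      cube c l ⊆ X → ENNReal.ofReal (l ^ (-(n - n / p) : ℝ)) * ∫⁻ x in cube c l, ‖f x‖ₑ ≤ δ := by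
  refine hS.induction_on (p := fun S => ∃ t > 0, ∀ (c : EuclideanSpace ℝ (Fin n)) (l : ℝ),
    0 < l → l ≤ t → c ∈ S → cube c l ⊆ X →
      ENNReal.ofReal (l ^ (-(n - n / p) : ℝ)) * ∫⁻ x in cube c l, ‖f x‖ₑ ≤ δ) ?_ ?_ ?_ ?_
  · exact ⟨1, one_pos, by simp⟩
  · rintro s t hst ⟨a, ha, h⟩
    exact ⟨a, ha, fun c l hl hla hc => h c l hl hla (hst hc)⟩
  · rintro s t ⟨a, ha, h⟩ ⟨b, hb, h'⟩
    refine ⟨min a b, lt_min ha hb, fun c l hl hla hc => ?_⟩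
    rcases hc with hc | hc
    · exact h c l hl (hla.trans (min_le_left _ _)) hc
    · exact h' c l hl (hla.trans (min_le_right _ _)) hc
  · intro x hx
    obtain ⟨t, ht, h⟩ := hf.exists_near hn hp (hSX x hx) hδ
    exact ⟨_, mem_nhdsWithin_of_mem_nhds (cube_mem_nhds x ht), t, ht, h⟩

theorem isCompact_closedCube (z : EuclideanSpace ℝ (Fin n)) (L : ℝ) :
    IsCompact {x : EuclideanSpace ℝ (Fin n) | ∀ i, |x i - z i| ≤ L / 2} := by
  have h := (isCompact_univ_pi fun i : Fin n => isCompact_closedBall (z i) (L / 2)).image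
    (PiLp.continuous_toLp 2 fun _ : Fin n => ℝ)
  convert h using 1
  ext x
  simp only [Set.mem_ofPred_eq, Set.mem_image, Set.mem_univ_pi, Metric.mem_closedBall, Real.dist_eq]
  exact ⟨fun hx => ⟨fun i => x i, hx, rfl⟩, by rintro ⟨y, hy, rfl⟩; exact hy⟩

theorem MemJN.exists_small_of_isCube (hn : 1 ≤ n) (hp : 1 < p) (hf : MemJN p X f)
    (hX : IsCube X) {δ : ℝ≥0∞} (hδ : δ ≠ 0) :
    ∃ t > 0, ∀ (c : EuclideanSpace ℝ (Fin n)) (l : ℝ), 0 < l → l ≤ t →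
      cube c l ⊆ X → ENNReal.ofReal (l ^ (-(n - n / p) : ℝ)) * ∫⁻ x in cube c l, ‖f x‖ₑ ≤ δ := by
  obtain ⟨z, L, hL, rfl⟩ := hX
  obtain ⟨t, ht, h⟩ := hf.exists_near_of_isCompact hn hp (isCompact_closedCube z L)
    (fun x hx => fillsOrthants_cube hx) hδ
  refine ⟨t, ht, fun c l hl hlt hc => h c l hl hlt (fun i => ?_) hc⟩
  exact (hc (fun i => by simpa using hl) i).le

/-! ### The whole space -/

/-- The averages over cubes of side length about `1` are uniformly bounded. -/
theorem MemJN.exists_enorm_setAverage_le (hn : 1 ≤ n) (hp : 1 < p) (hf : MemJN p Set.univ f) :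
    ∃ D : ℝ≥0∞, D ≠ ∞ ∧ ∀ (c : EuclideanSpace ℝ (Fin n)) (l : ℝ), 1 / 2 ≤ l → l ≤ 1 →
      ‖⨍ x in cube c l, f x‖ₑ ≤ D := by
  obtain ⟨K, hK⟩ := hf.exists_cube_bound
  have hKc : ∀ (c : EuclideanSpace ℝ (Fin n)) (l : ℝ), 0 < l →
      volume (cube c l) * meanOsc f (cube c l) ^ p ≤ (K : ℝ≥0∞) ^ p :=
    fun c l hl => hK _ ⟨c, l, hl, rfl⟩ (Set.subset_univ _)
  have hI : ∀ (c : EuclideanSpace ℝ (Fin n)) (l : ℝ), 0 < l → IntegrableOn f (cube c l) :=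
    fun c l hl => hf.integrableOn_cube hp hl (Set.subset_univ _)
  set q := ENNReal.ofReal ((1 / 2) ^ (-(n / p) : ℝ)) with hq
  set A := (ENNReal.ofReal ((1 / 2) ^ n))⁻¹ *
    ∫⁻ x in cube (0 : EuclideanSpace ℝ (Fin n)) 1, ‖f x‖ₑ with hA
  have hAt : A ≠ ∞ := by
    refine ENNReal.mul_ne_top (ENNReal.inv_ne_top.2 ?_) (hI 0 1 one_pos).2.ne
    rw [Ne, ENNReal.ofReal_eq_zero, not_le]
    positivity
  have hC := chainConst_ne_top hn hp
  -- The summands bound, in order: growing the cube about `c`, passing to a cube about the origin,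
  -- shrinking that one back to side `l`, and the average there. The factor `q` bounds `m ^ (-n/p)`
  -- for sides `m ≥ 1/2`.
  refine ⟨chainConst n p * K * q + 2 ^ n * (K * q) + chainConst n p * K * q + A, ?_, ?_⟩
  · finiteness
  intro c l hl1 hl2
  have hl : 0 < l := by linarith
  have hnp : (0 : ℝ) ≤ n / p := by positivity
  have hlq : ∀ m, l ≤ m → ENNReal.ofReal (m ^ (-(n / p) : ℝ)) ≤ q := fun m hm => by
    rw [hq]
    gcongr ENNReal.ofReal ?_
    exact Real.rpow_le_rpow_of_nonpos (by norm_num) (by linarith) (by linarith)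
  have hchain : ∀ (d : EuclideanSpace ℝ (Fin n)) (J : ℕ),
      ‖(⨍ x in cube d l, f x) - ⨍ x in cube d (2 ^ J * l), f x‖ₑ ≤ chainConst n p * K * q := by
    intro d J
    refine (enorm_setAverage_sub_le_chainConst (c := fun _ => d) hp hl J (fun j _ => ?_)
      (fun j _ => hI _ _ (by positivity)) (fun j _ => hKc _ _ (by positivity))).trans ?_
    · refine cube_subset_cube fun i => ?_
      rw [sub_self, abs_zero, pow_succ]
      nlinarith [pow_pos (two_pos (α := ℝ)) j]
    · gcongr
      exact hlq l le_rfl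
  -- As `l ≥ 1/2`, this gives `‖c‖ ≤ 2 ^ J * l / 2`, so one doubling recentres the cube at the
  -- origin.
  obtain ⟨J, hJ⟩ := pow_unbounded_of_one_lt (4 * ‖c‖) one_lt_two
  have hsub : cube c (2 ^ J * l) ⊆ cube 0 (2 * (2 ^ J * l)) := by
    refine cube_subset_cube fun i => ?_
    have h1 : |c i| ≤ ‖c‖ := PiLp.norm_apply_le c i
    simp only [PiLp.zero_apply, sub_zero]
    nlinarith [pow_pos (two_pos (α := ℝ)) J]
  have h2 := enorm_setAverage_sub_le (f := f) (by positivity : 0 < 2 ^ J * l) hsub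
    (hI _ _ (by positivity))
  have h3 : meanOsc f (cube (0 : EuclideanSpace ℝ (Fin n)) (2 * (2 ^ J * l))) ≤ K * q := by
    refine (meanOsc_le_of_volume_mul_le hp (by positivity) (hKc _ _ (by positivity))).trans ?_
    gcongr
    refine hlq _ ?_
    have : (1 : ℝ) ≤ 2 ^ J := one_le_pow₀ one_le_two
    nlinarith
  have h4 := hchain 0 (J + 1)
  have e : (2 : ℝ) ^ (J + 1) * l = 2 * (2 ^ J * l) := by ring
  rw [e] at h4
  have h5 : ‖⨍ x in cube (0 : EuclideanSpace ℝ (Fin n)) l, f x‖ₑ ≤ A :=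
    enorm_setAverage_le f (by norm_num) hl1 (cube_subset_cube fun i => by simp; linarith)
  set a := ⨍ x in cube c l, f x
  set b := ⨍ x in cube c (2 ^ J * l), f x
  set g := ⨍ x in cube (0 : EuclideanSpace ℝ (Fin n)) (2 * (2 ^ J * l)), f x
  set h := ⨍ x in cube (0 : EuclideanSpace ℝ (Fin n)) l, f x
  calc ‖a‖ₑ = ‖(a - b) + (b - g) + -(h - g) + h‖ₑ := by congr 1; ring
    _ ≤ ‖a - b‖ₑ + ‖b - g‖ₑ + ‖-(h - g)‖ₑ + ‖h‖ₑ := by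
      refine (enorm_add_le _ _).trans (add_le_add_left ?_ _)
      refine (enorm_add_le _ _).trans (add_le_add_left ?_ _)
      exact enorm_add_le _ _
    _ ≤ _ := by
      rw [enorm_neg]
      have h6 : ‖b - g‖ₑ ≤ 2 ^ n * (K * q) := h2.trans (by gcongr)
      exact add_le_add (add_le_add (add_le_add (hchain c J) h6) h4) h5

/-- Small cubes far away from the origin. -/
theorem MemJN.exists_far (hn : 1 ≤ n) (hp : 1 < p) (hf : MemJN p Set.univ f)
    {δ : ℝ≥0∞} (hδ : δ ≠ 0) :
    ∃ R > 0, ∃ t > 0, ∀ (c : EuclideanSpace ℝ (Fin n)) (l : ℝ), 0 < l → l ≤ t →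
      c ∉ cube (0 : EuclideanSpace ℝ (Fin n)) R →
      ENNReal.ofReal (l ^ (-(n - n / p) : ℝ)) * ∫⁻ x in cube c l, ‖f x‖ₑ ≤ δ := by
  obtain ⟨ε, hε, hεδ⟩ := exists_chainConst_mul_le hn hp hδ
  obtain ⟨U, hU, hUN⟩ := hf.exists_mem_filter hp (Bornology.cobounded _) hε
  obtain ⟨D, hD, hDle⟩ := hf.exists_enorm_setAverage_le hn hp
  have hδ2 : δ / 2 ≠ 0 := by simp [ENNReal.div_eq_zero_iff, hδ]
  obtain ⟨t, ⟨ht, ht1⟩, ht0⟩ := ((eventually_ofReal_rpow_mul_le hn hp hD hδ2).and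
    (mem_nhdsWithin_of_mem_nhds (Iio_mem_nhds one_pos)) |>.and self_mem_nhdsWithin).exists
  have ht0 : 0 < t := ht0
  have ht1 : t < 1 := ht1
  obtain ⟨R, hR0, hR⟩ := (Bornology.isBounded_compl_iff.2 hU).exists_pos_norm_le
  have hpos : (0 : ℝ) ≤ n / p := by positivity
  -- Such a centre has a coordinate of modulus at least `R + 1`; concentric cubes of side at most
  -- `1` then stay outside the ball of radius `R`, hence in `U`.
  refine ⟨2 * (R + 1), by positivity, t, ht0, fun c l hl hlt hc => ?_⟩
  obtain ⟨J, hJ1, hJ2⟩ := exists_pow_mul_mem_Ioc hl (by linarith : l ≤ 1)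
  have key := rpow_mul_lintegral_le_chain (f := f) (c := fun _ => c) hp hl J
    (fun j _ => cube_subset_cube fun i => by
      rw [sub_self, abs_zero, pow_succ]
      nlinarith [pow_pos (two_pos (α := ℝ)) j])
    (fun j hj => hf.integrableOn_cube hp (by positivity) (Set.subset_univ _)) (ε := ε)
    (fun j hj => by
      have hle : (2 : ℝ) ^ j * l ≤ 1 := by
        have : (2 : ℝ) ^ j ≤ 2 ^ J := pow_le_pow_right₀ (by norm_num) hj
        exact (mul_le_mul_of_nonneg_right this hl.le).trans hJ1
      refine hUN _ ⟨_, _, by positivity, rfl⟩ (Set.subset_univ _) (fun x hx => ?_) ?_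
      · by_contra hxU
        have h1 := hR x hxU
        refine hc fun i => ?_
        have h2 : |x i| ≤ ‖x‖ := PiLp.norm_apply_le x i
        have h3 := abs_lt.1 (hx i)
        have h4 := abs_le.1 (h2.trans h1)
        rw [PiLp.zero_apply, sub_zero, abs_lt]
        constructor <;> linarith [h3.1, h3.2, h4.1, h4.2]
      · rw [← Bornology.isBounded_def]
        refine (isCompact_closedCube c (2 ^ j * l)).isBounded.subset fun x hx i => (hx i).le)
  refine key.trans ?_
  rw [← ENNReal.add_halves δ]
  refine add_le_add (le_trans ?_ ht) hεδ
  gcongr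
  exact hDle _ _ hJ2.le hJ1

theorem MemJN.exists_small_univ (hn : 1 ≤ n) (hp : 1 < p) (hf : MemJN p Set.univ f)
    {δ : ℝ≥0∞} (hδ : δ ≠ 0) :
    ∃ t > 0, ∀ (c : EuclideanSpace ℝ (Fin n)) (l : ℝ), 0 < l → l ≤ t →
      ENNReal.ofReal (l ^ (-(n - n / p) : ℝ)) * ∫⁻ x in cube c l, ‖f x‖ₑ ≤ δ := by
  obtain ⟨R, hR, a, ha, h⟩ := hf.exists_far hn hp hδ
  obtain ⟨b, hb, h'⟩ := hf.exists_near_of_isCompact hn hp (isCompact_closedCube 0 R)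
    (fun x _ => fillsOrthants_univ x) hδ
  refine ⟨min a b, lt_min ha hb, fun c l hl hlt => ?_⟩
  by_cases hc : c ∈ cube (0 : EuclideanSpace ℝ (Fin n)) R
  · exact h' c l hl (hlt.trans (min_le_right _ _)) (fun i => (hc i).le) (Set.subset_univ _)
  · exact h c l hl (hlt.trans (min_le_left _ _)) hc

theorem MemJN.exists_small (hn : 1 ≤ n) (hp : 1 < p) (hf : MemJN p X f)
    (hX : IsCube X ∨ X = Set.univ) {δ : ℝ≥0∞} (hδ : δ ≠ 0) :
    ∃ t > 0, ∀ (c : EuclideanSpace ℝ (Fin n)) (l : ℝ), 0 < l → l ≤ t →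
      cube c l ⊆ X → ENNReal.ofReal (l ^ (-(n - n / p) : ℝ)) * ∫⁻ x in cube c l, ‖f x‖ₑ ≤ δ := by
  rcases hX with hX | rfl
  · exact hf.exists_small_of_isCube hn hp hX hδ
  · obtain ⟨t, ht, h⟩ := hf.exists_small_univ hn hp hδ
    exact ⟨t, ht, fun c l hl hlt _ => h c l hl hlt⟩

theorem MemJN.tendsto_smallCubeSup (hn : 1 ≤ n) (hp : 1 < p) (hf : MemJN p X f)
    (hX : IsCube X ∨ X = Set.univ) :
    Tendsto (fun a : ℝ => smallCubeSup p X f a) (𝓝[>] 0) (𝓝 0) := by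
  rw [ENNReal.tendsto_nhds_zero]
  intro δ hδ
  obtain ⟨t, ht, h⟩ := hf.exists_small hn hp hX hδ.ne'
  filter_upwards [mem_nhdsWithin_of_mem_nhds (Iio_mem_nhds ht)] with a ha
  refine iSup_le fun c => iSup_le fun l => iSup_le fun hl => iSup_le fun hla => iSup_le fun hc => ?_
  rw [volume_rpow_mul_setLAverage _ _ hl]
  exact h c l hl (hla.trans (le_of_lt ha)) hc

/-! ### From cubes to Morrey balls -/

/-- A small ball around a point of a cube meets the cube within a subcube of comparable size. -/
theorem exists_cube_of_ball {z x : EuclideanSpace ℝ (Fin n)} {L ρ : ℝ} (hx : x ∈ cube z L)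
    (hρL : 2 * ρ ≤ L) :
    ∃ c, cube c (2 * ρ) ⊆ cube z L ∧ Metric.ball x ρ ∩ cube z L ⊆ cube c (2 * ρ) := by
  -- Each coordinate of `x` is clamped so that the cube of side `2 * ρ` fits inside; `2 * ρ ≤ L`
  -- makes the clamping interval nonempty.
  set c : EuclideanSpace ℝ (Fin n) := WithLp.toLp 2 fun i =>
    max (z i - L / 2 + ρ) (min (x i) (z i + L / 2 - ρ)) with hc
  have hci : ∀ i, c i = max (z i - L / 2 + ρ) (min (x i) (z i + L / 2 - ρ)) := fun i => rfl
  refine ⟨c, cube_subset_cube fun i => ?_, fun y hy i => ?_⟩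
  · rw [hci, abs_le]
    constructor
    · linarith [le_max_left (z i - L / 2 + ρ) (min (x i) (z i + L / 2 - ρ))]
    · have : max (z i - L / 2 + ρ) (min (x i) (z i + L / 2 - ρ)) ≤ z i + L / 2 - ρ :=
        max_le (by linarith) (min_le_right _ _)
      linarith
  · have h1 : |y i - x i| < ρ := by
      have h2 : ‖(y - x) i‖ ≤ ‖y - x‖ := PiLp.norm_apply_le (y - x) i
      have h3 := hy.1
      rw [mem_ball_iff_norm] at h3
      exact lt_of_le_of_lt h2 h3
    have h2 := abs_lt.1 (hy.2 i)
    have h3 := abs_lt.1 (hx i)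
    have h4 := abs_lt.1 h1
    rw [hci, abs_lt]
    rcases max_cases (z i - L / 2 + ρ) (min (x i) (z i + L / 2 - ρ)) with h5 | h5 <;>
      rcases min_cases (x i) (z i + L / 2 - ρ) with h6 | h6 <;>
      rw [h5.1] <;> (try rw [h6.1]) <;> constructor <;> linarith [h5.2, h6.2, h6.1]

theorem MemJN.exists_morreyTerm_le (hn : 1 ≤ n) (hp : 1 < p) (hf : MemJN p X f)
    (hX : IsCube X) {δ : ℝ≥0∞} (hδ : δ ≠ 0) :
    ∃ t > 0, ∀ x ∈ X, ∀ ρ, 0 < ρ → ρ ≤ t → morreyTerm 1 ((n : ℝ) - (n : ℝ) / p) X f x ρ ≤ δ := by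
  -- The cost of replacing the radius `ρ` by the side `2 * ρ` in the Morrey weight.
  set k := ENNReal.ofReal (2 ^ (n - n / p : ℝ)) with hk
  have hk0 : k ≠ 0 := by
    rw [hk, Ne, ENNReal.ofReal_eq_zero, not_le]; positivity
  have hδk : δ / k ≠ 0 := by simp [ENNReal.div_eq_zero_iff, hδ, hk]
  obtain ⟨t, ht, h⟩ := hf.exists_small_of_isCube hn hp hX hδk
  obtain ⟨z, L, hL, rfl⟩ := hX
  refine ⟨min (t / 2) (L / 2), by positivity, fun x hx ρ hρ hρt => ?_⟩
  have h1 := hρt.trans (min_le_left _ _)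
  have h2 := hρt.trans (min_le_right _ _)
  obtain ⟨c, hc, hb⟩ := exists_cube_of_ball hx (by linarith : 2 * ρ ≤ L)
  have h3 := h c (2 * ρ) (by positivity) (by linarith) hc
  simp only [morreyTerm, ENNReal.rpow_one]
  have h4 : ENNReal.ofReal (ρ ^ (-(n - n / p) : ℝ)) =
      k * ENNReal.ofReal ((2 * ρ) ^ (-(n - n / p) : ℝ)) := by
    rw [hk, ← ENNReal.ofReal_mul (by positivity), Real.mul_rpow (by norm_num) hρ.le, ← mul_assoc,
      ← Real.rpow_add (by norm_num)]
    simp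
  calc _ ≤ ENNReal.ofReal (ρ ^ (-(n - n / p) : ℝ)) * ∫⁻ x in cube c (2 * ρ), ‖f x‖ₑ := by
        gcongr
    _ ≤ k * (δ / k) := by
        rw [h4, mul_assoc]
        gcongr
    _ = δ := ENNReal.mul_div_cancel hk0 (by simp [hk])

theorem MemJN.memVanishingMorrey (hn : 1 ≤ n) (hp : 1 < p) (hf : MemJN p X f) (hX : IsCube X) :
    MemVanishingMorrey 1 ((n : ℝ) - (n : ℝ) / p) X f := by
  refine ⟨⟨hf.1.aestronglyMeasurable, ?_⟩, ?_⟩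
  · obtain ⟨t, ht, h⟩ := hf.exists_morreyTerm_le hn hp hX one_ne_zero
    have hI : ∫⁻ x in X, ‖f x‖ₑ < ∞ := by
      obtain ⟨z, L, hL, rfl⟩ := hX
      exact (hf.integrableOn_cube hp hL le_rfl).2
    have hB : 1 + ENNReal.ofReal (t ^ (-(n - n / p) : ℝ)) * ∫⁻ x in X, ‖f x‖ₑ < ∞ :=
      ENNReal.add_lt_top.2 ⟨ENNReal.one_lt_top, ENNReal.mul_lt_top ENNReal.ofReal_lt_top hI⟩
    refine lt_of_le_of_lt (iSup₂_le fun x hx => iSup₂_le fun ρ hρ => ?_) hB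
    rcases le_total ρ t with hρt | hρt
    · exact (h x hx ρ hρ hρt).trans le_self_add
    -- For `ρ ≥ t` the weight is at most its value at `t`, and `f` is integrable over all of `X`.
    · refine le_trans ?_ le_add_self
      simp only [morreyTerm, ENNReal.rpow_one]
      have := rpow_neg_exponent_nonneg (n := n) hp
      gcongr ENNReal.ofReal ?_ * ?_
      · exact Real.rpow_le_rpow_of_nonpos ht hρt (by linarith)
      · exact lintegral_mono_set Set.inter_subset_right
  · rw [ENNReal.tendsto_nhds_zero]
    intro δ hδ
    obtain ⟨t, ht, h⟩ := hf.exists_morreyTerm_le hn hp hX hδ.ne'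
    filter_upwards [mem_nhdsWithin_of_mem_nhds (Iio_mem_nhds ht)] with r hr
    exact iSup₂_le fun x hx => iSup₂_le fun ρ hρ => iSup_le fun hρr =>
      h x hx ρ hρ (hρr.le.trans (le_of_lt hr))

end JohnNirenberg

theorem mainTheorem3 {n : ℕ} (hn : 1 ≤ n) (p : ℝ) (hp : 1 < p)
    (X : Set (EuclideanSpace ℝ (Fin n))) (hX : JohnNirenberg.IsCube X ∨ X = Set.univ)
    (f : EuclideanSpace ℝ (Fin n) → ℝ) (hf : JohnNirenberg.MemJN p X f) :
    Tendsto (fun a : ℝ => JohnNirenberg.smallCubeSup p X f a) (𝓝[>] 0) (𝓝 0) ∧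
      (JohnNirenberg.IsCube X →
        JohnNirenberg.MemVanishingMorrey 1 ((n : ℝ) - (n : ℝ) / p) X f) :=
  ⟨hf.tendsto_smallCubeSup hn hp hX, fun h => hf.memVanishingMorrey hn hp h⟩
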